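/- Let $T\ge 1$ be real, let $d$ be a natural number, and let $\theta,\sigma$ be real-valued functions that are positive on $[0,T]$, with $\theta$ integrable on $[0,T]$ and $\sigma_t^2 = 2\theta_t$ for all $t\in[0,T]$. Let $w$ be a standard $d$-dimensional Wiener process, and let $(\mathbf a^t)_{t\in[0,T]}$ be an $\mathbb R^d$-valued process with almost surely continuous paths that solves the mean-reverting SDE $$\mathrm d\mathbf a = -\theta_t\,\mathbf a\,\mathrm dt + \sigma_t\,\mathrm d w ,$$ where the initial variable $\mathbf a^0$ is independent of $w$ and has an arbitrary law. Write $\bar\theta_t := \int_0^t\theta_z\,\mathrm dz$ and $\theta'_t := \int_{t-1}^t\theta_z\,\mathrm dz$. Then for every real $t\in[1,T]$ the regular conditional distribution of $\mathbf a^{t-1}$ given $(\mathbf a^t,\mathbf a^0)$ is an isotropic Gaussian: $$p(\mathbf a^{t-1}\mid \mathbf a^t,\mathbf a^0) = \mathcal N\big(\mathbf a^{t-1}\mid \tilde\mu_t(\mathbf a^t,\mathbf a^0),\ \tilde\beta_t\,\mathbf I\big)$$ for almost every value of $(\mathbf a^t,\mathbf a^0)$ with respect to their joint law, where $$\tilde\mu_t(\mathbf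 a^t,\mathbf a^0) = \frac{1-e^{-2\bar\theta_{t-1}}}{1-e^{-2\bar\theta_t}}\,e^{-\theta'_t}\,\mathbf a^t + \frac{1-e^{-2\theta'_t}}{1-e^{-2\bar\theta_t}}\,e^{-\bar\theta_{t-1}}\,\mathbf a^0, \qquad \tilde\beta_t = \frac{(1-e^{-2\bar\theta_{t-1}})(1-e^{-2\theta'_t})}{1-e^{-2\bar\theta_t}}\ \ge 0 .$$ For $t=1$ the variance is $0$, and the Gaussian is understood as the point mass at $\tilde\mu_1(\mathbf a^1,\mathbf a^0)=\mathbf a^0$. -/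

import Mathlib

open MeasureTheory ProbabilityTheory Filter Topology Set
open scoped NNReal ENNReal

noncomputable section

namespace MeanReverting

/-- `w` is a standard `d`-dimensional Wiener process under `P`: its coordinates are mutually
independent standard real Brownian motions. -/
structure IsWiener {Ω : Type*} [MeasurableSpace Ω] {d : ℕ}
    (w : ℝ≥0 → Ω → EuclideanSpace ℝ (Fin d)) (P : Measure Ω) : Prop where
  coord : ∀ i : Fin d, IsBrownianReal (fun t ω => w t ω i) P
  indep : iIndepFun (fun (i : Fin d) (ω : Ω) (t : ℝ≥0) => w t ω i) P

/-- A deterministic step function on the half-line, with value `coeff k` on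
`(time k, time (k + 1)]` for `k < n`, and `0` elsewhere. -/
structure StepFunction where
  n : ℕ
  time : ℕ → ℝ≥0
  mono : Monotone time
  coeff : ℕ → ℝ

/-- The step function as a function of real time. -/
def StepFunction.toFun (φ : StepFunction) (s : ℝ) : ℝ :=
  ∑ k ∈ Finset.range φ.n,
    (Ioc (φ.time k : ℝ) (φ.time (k + 1) : ℝ)).indicator (fun _ => φ.coeff k) s

/-- The elementary stochastic integral of a step function against the real process `B`. -/
def StepFunction.integral {Ω : Type*} (φ : StepFunction) (B : ℝ≥0 → Ω → ℝ) (ω : Ω) : ℝ :=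
  ∑ k ∈ Finset.range φ.n, φ.coeff k * (B (φ.time (k + 1)) ω - B (φ.time k) ω)

/-- `I` is (a version of) the stochastic integral `∫₀ᵗ f dB` of the deterministic integrand
`f ∈ L²[0,t]`: the limit in `L²(P)` of the elementary integrals of step functions on `[0,t]` which
converge to `f` in `L²[0,t]`. When `B` is a Brownian motion such an `I` exists, is unique up to
`P`-null sets, and does not depend on the approximating sequence. -/
def IsStochIntegral {Ω : Type*} [MeasurableSpace Ω] (f : ℝ → ℝ) (B : ℝ≥0 → Ω → ℝ) (t : ℝ)
    (I : Ω → ℝ) (P : Measure Ω) : Prop :=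
  MemLp f 2 (volume.restrict (Icc 0 t)) ∧ MemLp I 2 P ∧
    ∃ φ : ℕ → StepFunction,
      (∀ n k, ((φ n).time k : ℝ) ≤ t) ∧
      Tendsto (fun n => eLpNorm (fun s => (φ n).toFun s - f s) 2 (volume.restrict (Icc 0 t)))
        atTop (𝓝 0) ∧
      Tendsto (fun n => eLpNorm (fun ω => (φ n).integral B ω - I ω) 2 P) atTop (𝓝 0)

/-- The process `a`, considered on `[0,T]`, solves `da = -θ_t a dt + σ_t dw`, with initial variable
`a 0` independent of the Wiener process `w`. The law of `a 0` is arbitrary. The field `sde` says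
that, coordinate by coordinate, `a_t = a_0 - ∫₀ᵗ θ_s a_s ds + ∫₀ᵗ σ_s dw_s`. -/
structure IsSolution {Ω : Type*} [MeasurableSpace Ω] {d : ℕ} (θ σ : ℝ → ℝ) (T : ℝ)
    (w : ℝ≥0 → Ω → EuclideanSpace ℝ (Fin d)) (a : ℝ → Ω → EuclideanSpace ℝ (Fin d))
    (P : Measure Ω) : Prop where
  aemeasurable : ∀ t ∈ Icc (0 : ℝ) T, AEMeasurable (a t) P
  indep : IndepFun (a 0) (fun ω t => w t ω) P
  continuous : ∀ᵐ ω ∂P, ContinuousOn (fun t => a t ω) (Icc (0 : ℝ) T)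
  sde : ∀ t ∈ Icc (0 : ℝ) T, ∀ i : Fin d,
    IsStochIntegral σ (fun s ω => w s ω i) t
      (fun ω => a t ω i - a 0 ω i + ∫ s in (0 : ℝ)..t, θ s * a s ω i) P

/-- `θ̄_{τ:t} = ∫_τ^t θ_z dz`. -/
def thetaBar (θ : ℝ → ℝ) (τ t : ℝ) : ℝ := ∫ z in τ..t, θ z

/-- The posterior mean `μ̃_t(aₜ, a₀)`; here `θ'_t` is `thetaBar θ (t - 1) t`. -/
def posteriorMean {d : ℕ} (θ : ℝ → ℝ) (t : ℝ) (aₜ a₀ : EuclideanSpace ℝ (Fin d)) :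
    EuclideanSpace ℝ (Fin d) :=
  ((1 - Real.exp (-2 * thetaBar θ 0 (t - 1))) / (1 - Real.exp (-2 * thetaBar θ 0 t))
      * Real.exp (-thetaBar θ (t - 1) t)) • aₜ
    + ((1 - Real.exp (-2 * thetaBar θ (t - 1) t)) / (1 - Real.exp (-2 * thetaBar θ 0 t))
      * Real.exp (-thetaBar θ 0 (t - 1))) • a₀

/-- The posterior variance `β̃_t`. -/
def posteriorVar (θ : ℝ → ℝ) (t : ℝ) : ℝ :=
  (1 - Real.exp (-2 * thetaBar θ 0 (t - 1))) * (1 - Real.exp (-2 * thetaBar θ (t - 1) t))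
    / (1 - Real.exp (-2 * thetaBar θ 0 t))

end MeanReverting

end

noncomputable section

namespace MeanReverting

/-! The integrating factor turns the equation into a Gaussian martingale: `e^θ̄_t a_t = a_0 + ∫₀ᵗ
e^θ̄ σ dw`. Write `es`, `et` for `e^θ̄` at `t - 1` and `t`, and `M`, `N` for the increments of `e^θ̄
a` over `[0, t-1]` and `[t-1, t]`. Because `σ² = 2θ`, the variables `a_0`, `M`, `N` are independent,
and `M`, `N` are centred isotropic Gaussians of variances `es² - 1` and `et² - es²`. The pair `(a_t,
a_0)` is a function of `(M + N, a_0)`, and `a_(t-1) - μ̃ = C M - G N`, with `C`, `G` such that this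
residual is uncorrelated with `M + N`. It is therefore independent of `(a_t, a_0)`, and the
conditional law is its Gaussian law translated by `μ̃`.

The probabilistic core is `integral_exp_increments`, the joint characteristic function of `a_0`,
`M`, `N`. It is obtained without Itô's formula. Left-point sums of `e^θ̄` against the martingale
part converge pathwise (`tendsto_riemannSum`). Those sums are Wiener integrals, and every element of
`wienerGraph` satisfies the Gaussian characteristic function identity
(`integral_exp_mul_exp_of_mem_wienerGraph`). Variances are inner products in `L²(ℝ)`, computed from
orthogonality of increments. Then `indepFun_prodMk_of_charFun` reads off independence and
`condDistrib_ae_eq_map_add` turns it into a conditional law. -/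

/-! ### Uniform partitions and pathwise integration by parts -/

/-- The `k`-th point of the partition of `[r, t]` into `n` intervals of equal length. -/
def unifPt (r t : ℝ) (n k : ℕ) : ℝ := r + k * ((t - r) / n)

lemma unifPt_zero (r t : ℝ) (n : ℕ) : unifPt r t n 0 = r := by simp [unifPt]

lemma unifPt_self (r t : ℝ) {n : ℕ} (hn : n ≠ 0) : unifPt r t n n = t := by
  have : (n : ℝ) ≠ 0 := by exact_mod_cast hn
  simp only [unifPt]; field_simp; ring

lemma unifPt_succ_sub (r t : ℝ) (n k : ℕ) :
    unifPt r t n (k + 1) - unifPt r t n k = (t - r) / n := by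
  simp only [unifPt]; push_cast; ring

lemma unifPt_mono {r t : ℝ} (hrt : r ≤ t) (n : ℕ) : Monotone (unifPt r t n) :=
  monotone_nat_of_le_succ fun k => by
    have := unifPt_succ_sub r t n k
    have h : 0 ≤ (t - r) / n := div_nonneg (by linarith) (by positivity)
    linarith

lemma unifPt_mem {r t : ℝ} (hrt : r ≤ t) {n k : ℕ} (hk : k ≤ n) :
    unifPt r t n k ∈ Icc r t := by
  rcases eq_or_ne n 0 with rfl | hn
  · obtain rfl : k = 0 := by omega
    simp [unifPt_zero, hrt]
  · exact ⟨(unifPt_zero r t n).symm.le.trans (unifPt_mono hrt n (Nat.zero_le k)),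
      (unifPt_mono hrt n hk).trans (unifPt_self r t hn).le⟩

/-- If `x = x_r - ∫ θ x + M`, then the left Riemann sums of `∫ e^Θ dM` over the uniform partitions
of `[r, t]` converge to `e^{Θ t} x t - e^{Θ r} x r`, where `Θ` is a primitive of `θ`. -/
lemma tendsto_riemannSum {θ Θ x : ℝ → ℝ} {r t : ℝ} (hrt : r ≤ t)
    (hθ : ∀ s ∈ Icc r t, 0 ≤ θ s) (hint : IntegrableOn θ (Icc r t))
    (hΘ : ∀ a ∈ Icc r t, ∀ b ∈ Icc r t, ∫ s in a..b, θ s = Θ b - Θ a)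
    (hΘc : ContinuousOn Θ (Icc r t)) (hx : ContinuousOn x (Icc r t)) :
    Tendsto (fun n : ℕ => ∑ k ∈ Finset.range n, Real.exp (Θ (unifPt r t n k)) *
      (x (unifPt r t n (k + 1)) - x (unifPt r t n k)
        + ∫ s in (unifPt r t n k)..(unifPt r t n (k + 1)), θ s * x s))
      atTop (𝓝 (Real.exp (Θ t) * x t - Real.exp (Θ r) * x r)) := by
  obtain ⟨K, hK⟩ := isCompact_Icc.exists_bound_of_continuousOn hx
  obtain ⟨C, hC⟩ := isCompact_Icc.exists_bound_of_continuousOn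
    (Real.continuous_exp.comp_continuousOn hΘc)
  have hK0 : 0 ≤ K := (norm_nonneg _).trans (hK r ⟨le_rfl, hrt⟩)
  have hC0 : 0 ≤ C := (norm_nonneg _).trans (hC r ⟨le_rfl, hrt⟩)
  have hΘ0 : 0 ≤ Θ t - Θ r := by
    rw [← hΘ r ⟨le_rfl, hrt⟩ t ⟨hrt, le_rfl⟩]
    exact intervalIntegral.integral_nonneg hrt hθ
  have hux := isCompact_Icc.uniformContinuousOn_of_continuous hx
  have huΘ := isCompact_Icc.uniformContinuousOn_of_continuous hΘc
  rw [Metric.uniformContinuousOn_iff_le] at hux huΘ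
  rw [Metric.tendsto_atTop']
  intro ε hε
  -- The total error will be at most `η (D - 1)`; the extra `1` makes `D` positive and the final
  -- inequality strict. The bound `η ≤ 1` is for the second-order estimate of `exp`, valid for
  -- increments at most `1`.
  set D := C * (K + 1) * (Θ t - Θ r) + 1 with hD
  have hDpos : 0 < D := by positivity
  obtain ⟨η, hη0, hη1, hηD⟩ : ∃ η : ℝ, 0 < η ∧ η ≤ 1 ∧ η * D ≤ ε := by
    refine ⟨min 1 (ε / D), by positivity, min_le_left _ _, ?_⟩
    calc min 1 (ε / D) * D ≤ ε / D * D := by gcongr; exact min_le_right _ _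
      _ = ε := by field_simp
  obtain ⟨δ₁, hδ₁, h₁⟩ := hux η hη0
  obtain ⟨δ₂, hδ₂, h₂⟩ := huΘ η hη0
  have hlim : Tendsto (fun n : ℕ => (t - r) / (n : ℝ)) atTop (𝓝 0) :=
    tendsto_const_div_atTop_nhds_zero_nat _
  have hev : ∀ᶠ n : ℕ in atTop, (t - r) / (n : ℝ) < min δ₁ δ₂ :=
    hlim.eventually_lt_const (by positivity)
  obtain ⟨N, hN⟩ := eventually_atTop.1 hev
  refine ⟨N, fun n hn => ?_⟩
  have hn0 : n ≠ 0 := by omega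
  have hmesh := hN n hn.le
  set s := unifPt r t n with hs
  have hmem : ∀ k ≤ n, s k ∈ Icc r t := fun k hk => unifPt_mem hrt hk
  have hmono : Monotone s := unifPt_mono hrt n
  have htel : Real.exp (Θ t) * x t - Real.exp (Θ r) * x r
      = ∑ k ∈ Finset.range n,
        (Real.exp (Θ (s (k + 1))) * x (s (k + 1)) - Real.exp (Θ (s k)) * x (s k)) := by
    rw [Finset.sum_range_sub (fun k => Real.exp (Θ (s k)) * x (s k))]
    rw [hs, unifPt_self r t hn0, unifPt_zero]
  -- Per interval, the error has two sources: replacing `x` by its right endpoint value in `∫ θ x`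
  -- (oscillation of `x`, at most `η`) and `e^Δ ≈ 1 + Δ` (at most `Δ² ≤ η Δ`). Both are proportional
  -- to `Δ`, the increment of `Θ`, so the bounds telescope.
  have hterm : ∀ k ∈ Finset.range n,
      |Real.exp (Θ (s k)) * (x (s (k + 1)) - x (s k) + ∫ u in (s k)..(s (k + 1)), θ u * x u)
        - (Real.exp (Θ (s (k + 1))) * x (s (k + 1)) - Real.exp (Θ (s k)) * x (s k))|
      ≤ C * (K + 1) * η * (Θ (s (k + 1)) - Θ (s k)) := by
    intro k hk
    have hk : k < n := Finset.mem_range.1 hk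
    have ma := hmem k hk.le
    have mb := hmem (k + 1) hk
    have hab : s k ≤ s (k + 1) := hmono (Nat.le_succ k)
    have hsub : Icc (s k) (s (k + 1)) ⊆ Icc r t := Icc_subset_Icc ma.1 mb.2
    have hd : s (k + 1) - s k = (t - r) / n := unifPt_succ_sub r t n k
    have hΔ : ∫ u in (s k)..(s (k + 1)), θ u = Θ (s (k + 1)) - Θ (s k) := hΘ _ ma _ mb
    have hΔ0 : 0 ≤ Θ (s (k + 1)) - Θ (s k) := by
      rw [← hΔ]; exact intervalIntegral.integral_nonneg hab fun u hu => hθ u (hsub hu)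
    have hΔη : Θ (s (k + 1)) - Θ (s k) ≤ η := by
      have := h₂ _ mb _ ma (by
        rw [Real.dist_eq, abs_of_nonneg (by linarith), hd]
        exact hmesh.le.trans (min_le_right _ _))
      rw [Real.dist_eq] at this
      exact (le_abs_self _).trans this
    have i1 : IntervalIntegrable θ volume (s k) (s (k + 1)) :=
      (intervalIntegrable_iff_integrableOn_Icc_of_le hab).2 (hint.mono_set hsub)
    have i2 : IntervalIntegrable (fun u => θ u * x u) volume (s k) (s (k + 1)) :=
      i1.mul_continuousOn (by rw [uIcc_of_le hab]; exact hx.mono hsub)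
    have hI : |(∫ u in (s k)..(s (k + 1)), θ u * x u)
        - (Θ (s (k + 1)) - Θ (s k)) * x (s (k + 1))| ≤ η * (Θ (s (k + 1)) - Θ (s k)) := by
      rw [← hΔ, ← intervalIntegral.integral_mul_const, ← intervalIntegral.integral_sub i2
        (i1.mul_const _), ← intervalIntegral.integral_const_mul, ← Real.norm_eq_abs]
      refine intervalIntegral.norm_integral_le_of_norm_le hab ?_ (i1.const_mul η)
      refine Eventually.of_forall fun u hu => ?_
      have hu' : u ∈ Icc (s k) (s (k + 1)) := Ioc_subset_Icc_self hu
      have hxu := h₁ u (hsub hu') _ mb (by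
        rw [Real.dist_eq, abs_sub_comm, abs_of_nonneg (by linarith [hu'.2])]
        have := hmesh.le.trans (min_le_left _ _)
        linarith [hu'.1])
      rw [Real.dist_eq] at hxu
      rw [← mul_sub, Real.norm_eq_abs, abs_mul, abs_of_nonneg (hθ u (hsub hu')), mul_comm]
      exact mul_le_mul_of_nonneg_right hxu (hθ u (hsub hu'))
    have hE := Real.abs_exp_sub_one_sub_id_le
      (x := Θ (s (k + 1)) - Θ (s k)) (by rw [abs_of_nonneg hΔ0]; linarith)
    have hsplit : Real.exp (Θ (s (k + 1)))
        = Real.exp (Θ (s k)) * Real.exp (Θ (s (k + 1)) - Θ (s k)) := by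
      rw [← Real.exp_add]; congr 1; ring
    have hxK := hK _ mb
    rw [Real.norm_eq_abs] at hxK
    have hCk := hC _ ma
    rw [Real.norm_eq_abs, Function.comp_apply, abs_of_pos (Real.exp_pos _)] at hCk
    rw [hsplit]
    set Δ := Θ (s (k + 1)) - Θ (s k)
    set J := ∫ u in (s k)..(s (k + 1)), θ u * x u
    have e1 : Real.exp (Θ (s k)) * (x (s (k + 1)) - x (s k) + J)
        - (Real.exp (Θ (s k)) * Real.exp Δ * x (s (k + 1)) - Real.exp (Θ (s k)) * x (s k))
        = Real.exp (Θ (s k)) * ((J - Δ * x (s (k + 1)))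
          - (Real.exp Δ - 1 - Δ) * x (s (k + 1))) := by ring
    rw [e1, abs_mul, abs_of_pos (Real.exp_pos _)]
    have e2 : |(J - Δ * x (s (k + 1))) - (Real.exp Δ - 1 - Δ) * x (s (k + 1))|
        ≤ η * Δ + Δ ^ 2 * K := by
      refine (abs_sub _ _).trans (add_le_add hI ?_)
      rw [abs_mul]
      exact mul_le_mul hE hxK (abs_nonneg _) (sq_nonneg _)
    have e3 : η * Δ + Δ ^ 2 * K ≤ (K + 1) * η * Δ := by
      nlinarith [mul_le_mul_of_nonneg_right hΔη (mul_nonneg hΔ0 hK0)]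
    calc _ ≤ C * ((K + 1) * η * Δ) :=
          mul_le_mul hCk (e2.trans e3) (abs_nonneg _) hC0
      _ = _ := by ring
  rw [Real.dist_eq, htel, ← Finset.sum_sub_distrib]
  calc _ ≤ ∑ k ∈ Finset.range n, C * (K + 1) * η * (Θ (s (k + 1)) - Θ (s k)) :=
        (Finset.abs_sum_le_sum_abs _ _).trans (Finset.sum_le_sum hterm)
    _ = C * (K + 1) * η * (Θ t - Θ r) := by
        rw [← Finset.mul_sum, Finset.sum_range_sub (fun k => Θ (s k)), hs,
          unifPt_self r t hn0, unifPt_zero]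
    _ = η * D - η := by rw [hD]; ring
    _ < ε := by linarith

/-! ### Wiener integrals as a closed subspace of `L²(ℝ) × L²(P)` -/

/-- The indicator of `(0, t]` as an element of `L²(ℝ)`. -/
def indicatorL2 (t : ℝ≥0) : Lp ℝ 2 (volume : Measure ℝ) :=
  indicatorConstLp 2 (measurableSet_Ioc (a := (0 : ℝ)) (b := t)) (by simp) 1

/-- This is the Brownian covariance, so `1_(0,t] ↦ B t` preserves inner products. -/
lemma inner_indicatorL2 (s t : ℝ≥0) :
    inner ℝ (indicatorL2 s) (indicatorL2 t) = ((min s t : ℝ≥0) : ℝ) := by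
  rw [indicatorL2, indicatorL2, L2.real_inner_indicatorConstLp_one_indicatorConstLp_one _ _ (by simp) (by simp),
    Ioc_inter_Ioc, Real.volume_real_Ioc]
  simp

section Gaussian

variable {Ω : Type*} [MeasurableSpace Ω] {P : Measure Ω} {B : ℝ≥0 → Ω → ℝ}

lemma memLp_two_of_isPreBrownianReal (hB : IsPreBrownianReal B P) (t : ℝ≥0) : MemLp (B t) 2 P :=
  (hB.isGaussianProcess.hasGaussianLaw_eval t).memLp_two

/-- The Wiener isometry sends the step function `∑ c_t 1_(0,t]` to a centred Gaussian variable whose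
variance is the squared norm of the step function. -/
lemma integral_exp_sum_brownian (hB : IsPreBrownianReal B P) (c : ℝ≥0 →₀ ℝ) :
    ∫ ω, Complex.exp (((∑ t ∈ c.support, c t * B t ω : ℝ) : ℂ) * Complex.I) ∂P
      = Complex.exp (-((‖∑ t ∈ c.support, c t • indicatorL2 t‖ ^ 2 / 2 : ℝ) : ℂ)) := by
  have hP := hB.isGaussianProcess.isProbabilityMeasure
  set X : Ω → ℝ := fun ω => ∑ t ∈ c.support, c t * B t ω with hX
  have hG : HasGaussianLaw X P := by
    have h := (hB.isGaussianProcess.hasGaussianLaw c.support).map_fun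
      (∑ t : c.support, c t • ContinuousLinearMap.proj (R := ℝ) (φ := fun _ => ℝ) t)
    have h' : (fun ω => (∑ t : c.support, c t • ContinuousLinearMap.proj (R := ℝ)
        (φ := fun _ => ℝ) t) (c.support.restrict fun x => B x ω)) = X := by
      ext ω
      change _ = ∑ t ∈ c.support, c t * B t ω
      rw [← Finset.sum_coe_sort c.support (fun t => c t * B t ω)]
      simp [Finset.restrict]
    rwa [h'] at h
  have hmean : P[X] = 0 := by
    rw [hX, integral_finsetSum _ fun t _ => (hB.integrable_eval t).const_mul _]
    refine Finset.sum_eq_zero fun t _ => ?_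
    rw [integral_const_mul, hB.integral_eval, mul_zero]
  have hvar : Var[X; P] = ‖∑ t ∈ c.support, c t • indicatorL2 t‖ ^ 2 := by
    rw [hX, variance_fun_sum' fun t _ => (memLp_two_of_isPreBrownianReal hB t).const_mul _,
      ← real_inner_self_eq_norm_sq, sum_inner]
    refine Finset.sum_congr rfl fun s _ => ?_
    rw [inner_sum]
    refine Finset.sum_congr rfl fun t _ => ?_
    rw [covariance_const_mul_left, covariance_const_mul_right, hB.covariance_fun_eval,
      real_inner_smul_left, real_inner_smul_right, inner_indicatorL2]
  have h1 : ∫ ω, Complex.exp ((X ω : ℂ) * Complex.I) ∂P = charFun (P.map X) 1 := by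
    rw [charFun_apply_real, integral_map hG.aemeasurable (by fun_prop)]
    simp
  rw [h1, hG.map_eq_gaussianReal, charFun_gaussianReal, hmean, ← hvar,
    Real.coe_toNNReal _ (variance_nonneg _ _)]
  simp

/-- The graph of the Wiener integral `L²(ℝ) → L²(P)` with respect to `B`: the closed linear span of
the pairs `(1_(0,t], B t)`. -/
def wienerGraph (hB : IsPreBrownianReal B P) :
    Submodule ℝ (Lp ℝ 2 (volume : Measure ℝ) × Lp ℝ 2 P) :=
  (Submodule.span ℝ (range fun t : ℝ≥0 =>
    (indicatorL2 t, (memLp_two_of_isPreBrownianReal hB t).toLp))).topologicalClosure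

/-- Working with the graph avoids constructing the integral as a map: only linearity and closedness
of the set of pairs are used. -/
lemma mk_mem_wienerGraph (hB : IsPreBrownianReal B P) (t : ℝ≥0) :
    (indicatorL2 t, (memLp_two_of_isPreBrownianReal hB t).toLp) ∈ wienerGraph hB :=
  Submodule.le_topologicalClosure _ (Submodule.subset_span ⟨t, rfl⟩)

end Gaussian

lemma norm_exp_mul_I_sub_le (a b : ℝ) :
    ‖Complex.exp (a * Complex.I) - Complex.exp (b * Complex.I)‖ ≤ |a - b| := by
  have h : Complex.exp (a * Complex.I) - Complex.exp (b * Complex.I)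
      = Complex.exp (b * Complex.I) * (Complex.exp (Complex.I * ((a - b : ℝ) : ℂ)) - 1) := by
    rw [mul_sub, ← Complex.exp_add]
    congr 1
    · congr 1; push_cast; ring
    · simp
  rw [h, norm_mul, Complex.norm_exp_ofReal_mul_I, one_mul, ← Real.norm_eq_abs]
  exact Real.norm_exp_I_mul_ofReal_sub_one_le

/-! ### Joint characteristic function of Wiener integrals and the initial variable -/

section Joint

variable {Ω : Type*} [MeasurableSpace Ω] {P : Measure Ω} [IsProbabilityMeasure P]

lemma integrable_exp_mul_I {Y : Ω → ℝ} (hY : AEMeasurable Y P) :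
    Integrable (fun ω => Complex.exp ((Y ω : ℂ) * Complex.I)) P :=
  .of_bound (by fun_prop) 1 (Eventually.of_forall fun ω => (Complex.norm_exp_ofReal_mul_I _).le)

/-- Since `x ↦ e^(ix)` is 1-Lipschitz and `|e^(iY)| = 1`, the integral is 1-Lipschitz in the `L¹`
norm, hence in the `L²` norm for a probability measure. It makes characteristic function identities
closed conditions in `L²(P)`. -/
lemma continuous_integral_exp_mul_exp {Y : Ω → ℝ} (hY : AEMeasurable Y P) :
    Continuous fun X : Lp ℝ 2 P =>
      ∫ ω, Complex.exp ((Y ω : ℂ) * Complex.I) * Complex.exp ((X ω : ℂ) * Complex.I) ∂P := by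
  have hint (X : Lp ℝ 2 P) : Integrable (fun ω => Complex.exp ((Y ω : ℂ) * Complex.I)
      * Complex.exp ((X ω : ℂ) * Complex.I)) P := by
    have := integrable_exp_mul_I (hY.add (Lp.aestronglyMeasurable X).aemeasurable)
    refine this.congr (Eventually.of_forall fun ω => ?_)
    simp [← Complex.exp_add, add_mul]
  refine LipschitzWith.continuous (K := 1) (LipschitzWith.of_dist_le_mul fun X X' => ?_)
  have hL1 : Integrable (fun ω => (X - X' : Lp ℝ 2 P) ω) P :=
    (Lp.memLp (X - X')).integrable (by norm_num)
  rw [dist_eq_norm, dist_eq_norm, ← integral_sub (hint X) (hint X'), NNReal.coe_one, one_mul]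
  calc _ ≤ ∫ ω, ‖(X - X' : Lp ℝ 2 P) ω‖ ∂P := by
        refine norm_integral_le_of_norm_le hL1.norm ?_
        filter_upwards [Lp.coeFn_sub X X'] with ω hω
        rw [← mul_sub, norm_mul, Complex.norm_exp_ofReal_mul_I, one_mul, hω, Pi.sub_apply]
        exact norm_exp_mul_I_sub_le _ _
    _ = (eLpNorm (X - X' : Lp ℝ 2 P) 1 P).toReal := by
        rw [eLpNorm_one_eq_lintegral_enorm, integral_norm_eq_lintegral_enorm
          (Lp.aestronglyMeasurable _)]
    _ ≤ ‖X - X'‖ := by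
        rw [Lp.norm_def]
        exact ENNReal.toReal_mono (Lp.eLpNorm_ne_top _)
          (eLpNorm_le_eLpNorm_of_exponent_le (by norm_num) (Lp.aestronglyMeasurable _))

/-- The Wiener integrals of deterministic functions `f i` against the independent Brownian motions
`w i` are jointly centred Gaussian, with independent coordinates, and independent of `A`. -/
lemma integral_exp_mul_exp_of_mem_wienerGraph {d : ℕ}
    {w : ℝ≥0 → Ω → EuclideanSpace ℝ (Fin d)}
    (hB : ∀ i, IsPreBrownianReal (fun t ω => w t ω i) P)
    (hindep : iIndepFun (fun (i : Fin d) (ω : Ω) (t : ℝ≥0) => w t ω i) P)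
    {A : Ω → EuclideanSpace ℝ (Fin d)} (hA : AEMeasurable A P)
    (hAw : IndepFun A (fun ω t => w t ω) P) (u : EuclideanSpace ℝ (Fin d))
    (z : Fin d → Lp ℝ 2 (volume : Measure ℝ) × Lp ℝ 2 P) (hz : ∀ i, z i ∈ wienerGraph (hB i)) :
    ∫ ω, Complex.exp (((inner ℝ (A ω) u : ℝ) : ℂ) * Complex.I)
        * Complex.exp ((((∑ i, (z i).2 : Lp ℝ 2 P) ω : ℝ) : ℂ) * Complex.I) ∂P
      = charFun (P.map A) u * Complex.exp (-((∑ i, ‖(z i).1‖ ^ 2 / 2 : ℝ) : ℂ)) := by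
  have hY : AEMeasurable (fun ω => (inner ℝ (A ω) u : ℝ)) P := hA.inner_const
  set S : Fin d → Set (Lp ℝ 2 (volume : Measure ℝ) × Lp ℝ 2 P) := fun i =>
    (Submodule.span ℝ (range fun t : ℝ≥0 =>
      (indicatorL2 t, (memLp_two_of_isPreBrownianReal (hB i) t).toLp)) : Set _) with hS
  set T : Set (Fin d → Lp ℝ 2 (volume : Measure ℝ) × Lp ℝ 2 P) :=
    {z | ∫ ω, Complex.exp (((inner ℝ (A ω) u : ℝ) : ℂ) * Complex.I)
        * Complex.exp ((((∑ i, (z i).2 : Lp ℝ 2 P) ω : ℝ) : ℂ) * Complex.I) ∂P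
      = charFun (P.map A) u * Complex.exp (-((∑ i, ‖(z i).1‖ ^ 2 / 2 : ℝ) : ℂ))} with hT
  have hclosed : IsClosed T := by
    refine isClosed_eq ?_ (by fun_prop)
    exact (continuous_integral_exp_mul_exp hY).comp (by fun_prop)
  -- The closure of a product is the product of closures, so it suffices to treat finite
  -- combinations of Brownian values in every coordinate at once.
  have hz' : z ∈ closure (univ.pi S) := by
    rw [closure_pi_set]
    exact fun i _ => hz i
  refine closure_minimal ?_ hclosed hz'
  intro z hz
  have hc : ∀ i, ∃ c : ℝ≥0 →₀ ℝ, c.sum (fun t a => a •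
      (indicatorL2 t, (memLp_two_of_isPreBrownianReal (hB i) t).toLp)) = z i := fun i =>
    Finsupp.mem_span_range_iff_exists_finsupp.1 (hz i (mem_univ i))
  choose c hc using hc
  have h1 : ∀ i, (z i).1 = ∑ t ∈ (c i).support, c i t • indicatorL2 t := fun i => by
    rw [← hc i, Finsupp.sum, Prod.fst_sum]; rfl
  have h2 : ∀ i, (z i).2 = ∑ t ∈ (c i).support,
      c i t • (memLp_two_of_isPreBrownianReal (hB i) t).toLp := fun i => by
    rw [← hc i, Finsupp.sum, Prod.snd_sum]; rfl
  set X : Fin d → Ω → ℝ := fun i ω => ∑ t ∈ (c i).support, c i t * w t ω i with hX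
  have hzX : ∀ᵐ ω ∂P, (∑ i, (z i).2 : Lp ℝ 2 P) ω = ∑ i, X i ω := by
    have e1 := Lp.coeFn_finsetSum (μ := P) Finset.univ (fun i => (z i).2)
    have e2 : ∀ᵐ ω ∂P, ∀ i, (z i).2 ω = X i ω := by
      refine ae_all_iff.2 fun i => ?_
      rw [h2 i]
      have e3 := Lp.coeFn_finsetSum (μ := P) (c i).support
        (fun t => c i t • (memLp_two_of_isPreBrownianReal (hB i) t).toLp)
      have e4 : ∀ᵐ ω ∂P, ∀ t ∈ (c i).support,
          (c i t • (memLp_two_of_isPreBrownianReal (hB i) t).toLp : Lp ℝ 2 P) ω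
            = c i t * w t ω i := by
        refine (ae_ball_iff (c i).support.countable_toSet).2 fun t _ => ?_
        filter_upwards [Lp.coeFn_smul (c i t) (memLp_two_of_isPreBrownianReal (hB i) t).toLp,
          (memLp_two_of_isPreBrownianReal (hB i) t).coeFn_toLp] with ω a1 a2
        rw [a1, Pi.smul_apply, a2, smul_eq_mul]
      filter_upwards [e3, e4] with ω a3 a4
      rw [a3, Finset.sum_apply]
      exact Finset.sum_congr rfl a4
    filter_upwards [e1, e2] with ω a1 a2
    rw [a1, Finset.sum_apply]
    exact Finset.sum_congr rfl fun i _ => a2 i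
  have hmX : ∀ i, AEMeasurable (X i) P := fun i =>
    Finset.aemeasurable_fun_sum _ fun t _ => ((hB i).aemeasurable t).const_mul _
  have hiX : iIndepFun X P :=
    hindep.comp (fun i (p : ℝ≥0 → ℝ) => ∑ t ∈ (c i).support, c i t * p t) (fun i => by fun_prop)
  have hAX : IndepFun A (fun ω => ∑ i, X i ω) P :=
    hAw.comp (φ := id) (ψ := fun p : ℝ≥0 → EuclideanSpace ℝ (Fin d) =>
      ∑ i, ∑ t ∈ (c i).support, c i t * p t i) measurable_id (by fun_prop)
  have hsum : AEMeasurable (fun ω => ∑ i, X i ω) P :=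
    Finset.aemeasurable_fun_sum _ fun i _ => hmX i
  rw [hT, mem_ofPred_eq]
  have e5 : ∫ ω, Complex.exp (((inner ℝ (A ω) u : ℝ) : ℂ) * Complex.I)
        * Complex.exp ((((∑ i, (z i).2 : Lp ℝ 2 P) ω : ℝ) : ℂ) * Complex.I) ∂P
      = ∫ ω, Complex.exp (((inner ℝ (A ω) u : ℝ) : ℂ) * Complex.I)
        * Complex.exp (((∑ i, X i ω : ℝ) : ℂ) * Complex.I) ∂P := by
    refine integral_congr_ae ?_
    filter_upwards [hzX] with ω hω
    rw [hω]
  rw [e5, hAX.integral_fun_comp_mul_comp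
    (f := fun x => Complex.exp (((inner ℝ x u : ℝ) : ℂ) * Complex.I))
    (g := fun x : ℝ => Complex.exp ((x : ℂ) * Complex.I)) hA hsum (by fun_prop) (by fun_prop)]
  congr 1
  · rw [charFun_apply, integral_map hA (by fun_prop)]
  · have e6 : ∫ ω, Complex.exp (((∑ i, X i ω : ℝ) : ℂ) * Complex.I) ∂P
        = charFun (P.map fun ω => ∑ i, X i ω) 1 := by
      rw [charFun_apply_real, integral_map hsum (by fun_prop)]; simp
    rw [e6, hiX.charFun_map_fun_sum_eq_prod hmX, Finset.prod_apply, Complex.ofReal_sum,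
      ← Finset.sum_neg_distrib, Complex.exp_sum]
    refine Finset.prod_congr rfl fun i _ => ?_
    rw [h1 i, ← integral_exp_sum_brownian (hB i) (c i), charFun_apply_real,
      integral_map (hmX i) (by fun_prop)]
    simp [hX]

end Joint

/-! ### Stochastic integrals lie in the Wiener graph -/

section Graph

variable {Ω : Type*} [MeasurableSpace Ω] {P : Measure Ω} {B : ℝ≥0 → Ω → ℝ}

/-- As `1_(s,t] = 1_(0,t] - 1_(0,s]` for `s ≤ t`, a step function and its elementary integral are
the same linear combination of the two components of the generators. -/
lemma StepFunction.exists_mem_wienerGraph (hB : IsPreBrownianReal B P) (φ : StepFunction) :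
    ∃ z ∈ wienerGraph hB, z.1 =ᵐ[volume] φ.toFun ∧ z.2 =ᵐ[P] φ.integral B := by
  set gen : ℝ≥0 → Lp ℝ 2 (volume : Measure ℝ) × Lp ℝ 2 P := fun t =>
    (indicatorL2 t, (memLp_two_of_isPreBrownianReal hB t).toLp) with hgen
  refine ⟨∑ k ∈ Finset.range φ.n, φ.coeff k • (gen (φ.time (k + 1)) - gen (φ.time k)),
    Submodule.sum_mem _ fun k _ => Submodule.smul_mem _ _ (Submodule.sub_mem _
      (mk_mem_wienerGraph hB _) (mk_mem_wienerGraph hB _)), ?_, ?_⟩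
  · rw [Prod.fst_sum]
    have h1 : ∀ᵐ x : ℝ, ∀ k, indicatorL2 (φ.time k) x
        = (Ioc (0 : ℝ) (φ.time k)).indicator (fun _ => (1 : ℝ)) x :=
      ae_all_iff.2 fun k => indicatorConstLp_coeFn
    have h2 : ∀ᵐ x : ℝ, ∀ k, (φ.coeff k • (gen (φ.time (k + 1)) - gen (φ.time k))).1 x
        = φ.coeff k * (indicatorL2 (φ.time (k + 1)) x - indicatorL2 (φ.time k) x) := by
      refine ae_all_iff.2 fun k => ?_
      filter_upwards [Lp.coeFn_smul (φ.coeff k)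
          (indicatorL2 (φ.time (k + 1)) - indicatorL2 (φ.time k)),
        Lp.coeFn_sub (indicatorL2 (φ.time (k + 1))) (indicatorL2 (φ.time k))] with x a1 a2
      rw [Pi.smul_apply, a2, Pi.sub_apply, smul_eq_mul] at a1
      exact a1
    filter_upwards [h1, h2, Lp.coeFn_finsetSum (μ := volume) (Finset.range φ.n) (fun k =>
      (φ.coeff k • (gen (φ.time (k + 1)) - gen (φ.time k))).1)] with x a1 a2 a3
    rw [a3, Finset.sum_apply]
    refine Finset.sum_congr rfl fun k _ => ?_
    rw [a2, a1, a1]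
    have hk : (φ.time k : ℝ) ≤ φ.time (k + 1) := by exact_mod_cast φ.mono (Nat.le_succ k)
    have h0 : (0 : ℝ) ≤ φ.time k := (φ.time k).2
    simp only [indicator_apply, mem_Ioc]
    split_ifs <;> grind
  · rw [Prod.snd_sum]
    have h1 : ∀ᵐ x ∂P, ∀ k, (gen (φ.time k)).2 x
        = B (φ.time k) x :=
      ae_all_iff.2 fun k => (memLp_two_of_isPreBrownianReal hB (φ.time k)).coeFn_toLp
    have h2 : ∀ᵐ x ∂P, ∀ k, (φ.coeff k • (gen (φ.time (k + 1)) - gen (φ.time k))).2 x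
        = φ.coeff k * ((gen (φ.time (k + 1))).2 x - (gen (φ.time k)).2 x) := by
      refine ae_all_iff.2 fun k => ?_
      filter_upwards [Lp.coeFn_smul (φ.coeff k)
          ((gen (φ.time (k + 1))).2 - (gen (φ.time k)).2),
        Lp.coeFn_sub (gen (φ.time (k + 1))).2 (gen (φ.time k)).2] with x a1 a2
      rw [Pi.smul_apply, a2, Pi.sub_apply, smul_eq_mul] at a1
      exact a1
    filter_upwards [h1, h2, Lp.coeFn_finsetSum (μ := P) (Finset.range φ.n) (fun k =>
      (φ.coeff k • (gen (φ.time (k + 1)) - gen (φ.time k))).2)] with x a1 a2 a3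
    rw [a3, Finset.sum_apply]
    refine Finset.sum_congr rfl fun k _ => ?_
    rw [a2, hgen, a1, a1]

lemma IsStochIntegral.exists_mem_wienerGraph (hB : IsPreBrownianReal B P) {f : ℝ → ℝ} {t : ℝ}
    {I : Ω → ℝ} (h : IsStochIntegral f B t I P) :
    ∃ z ∈ wienerGraph hB, z.1 =ᵐ[volume] (Icc 0 t).indicator f ∧ z.2 =ᵐ[P] I := by
  obtain ⟨hf, hI, φ, hφt, hφf, hφI⟩ := h
  have hf' : MemLp ((Icc 0 t).indicator f) 2 volume :=
    (memLp_indicator_iff_restrict measurableSet_Icc).2 hf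
  choose z hz hz1 hz2 using fun n => (φ n).exists_mem_wienerGraph hB
  refine ⟨(hf'.toLp, hI.toLp), ?_, hf'.coeFn_toLp, hI.coeFn_toLp⟩
  have hclosed : IsClosed (wienerGraph hB : Set (Lp ℝ 2 (volume : Measure ℝ) × Lp ℝ 2 P)) :=
    Submodule.isClosed_topologicalClosure _
  refine hclosed.mem_of_tendsto (f := z) (b := atTop) ?_ (Eventually.of_forall hz)
  refine Tendsto.prodMk_nhds (mx := fun n => (z n).1) (my := fun n => (z n).2) ?_ ?_
  · rw [Lp.tendsto_Lp_iff_tendsto_eLpNorm']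
    refine hφf.congr fun n => ?_
    rw [← eLpNorm_indicator_eq_eLpNorm_restrict measurableSet_Icc]
    refine eLpNorm_congr_ae ?_
    filter_upwards [hz1 n, hf'.coeFn_toLp] with x a1 a2
    rw [Pi.sub_apply, a1, a2]
    -- Outside `[0, t]` the step functions vanish, since all their times lie in `[0, t]`; hence
    -- convergence on `[0, t]` is convergence in `L²(ℝ)`.
    by_cases hx : x ∈ Icc 0 t
    · simp [hx]
    · rw [indicator_of_notMem hx, indicator_of_notMem hx, sub_zero, StepFunction.toFun]
      refine (Finset.sum_eq_zero fun k _ => indicator_of_notMem (fun hk => hx ?_) _).symm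
      exact ⟨((φ n).time k).2.trans hk.1.le, hk.2.trans (hφt n _)⟩
  · rw [Lp.tendsto_Lp_iff_tendsto_eLpNorm']
    refine hφI.congr fun n => eLpNorm_congr_ae ?_
    filter_upwards [hz2 n, hI.coeFn_toLp] with x a1 a2
    rw [Pi.sub_apply, a1, a2]

end Graph

/-! ### Orthogonal increments in a Hilbert space -/

section Increments

variable {H : Type*} [NormedAddCommGroup H] [InnerProductSpace ℝ H] {h : ℝ → H} {V : ℝ → ℝ}
  {U : Set ℝ}

/-- The inner product depends only on the earlier time, as for a Brownian motion run with clock `V`;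
hence the four terms cancel in pairs. -/
lemma inner_increment_eq_zero (hV : ∀ s ∈ U, ∀ r ∈ U, s ≤ r → inner ℝ (h s) (h r) = V s)
    {a b c d : ℝ} (ha : a ∈ U) (hb : b ∈ U) (hc : c ∈ U) (hd : d ∈ U)
    (hab : a ≤ b) (hbc : b ≤ c) (hcd : c ≤ d) : inner ℝ (h b - h a) (h d - h c) = 0 := by
  rw [inner_sub_left, inner_sub_right, inner_sub_right, hV b hb d hd (hbc.trans hcd),
    hV b hb c hc hbc, hV a ha d hd (hab.trans (hbc.trans hcd)), hV a ha c hc (hab.trans hbc)]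
  ring

lemma inner_increment_self (hV : ∀ s ∈ U, ∀ r ∈ U, s ≤ r → inner ℝ (h s) (h r) = V s)
    {a b : ℝ} (ha : a ∈ U) (hb : b ∈ U) (hab : a ≤ b) :
    inner ℝ (h b - h a) (h b - h a) = V b - V a := by
  rw [inner_sub_left, inner_sub_right, inner_sub_right, hV b hb b hb le_rfl,
    real_inner_comm, hV a ha b hb hab, hV a ha a ha le_rfl]
  ring

lemma norm_sq_sum_increments (hV : ∀ s ∈ U, ∀ r ∈ U, s ≤ r → inner ℝ (h s) (h r) = V s)
    {n : ℕ} {p : ℕ → ℝ} (hp : Monotone p) (hU : ∀ k ≤ n, p k ∈ U) (γ : ℕ → ℝ) :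
    ‖∑ k ∈ Finset.range n, γ k • (h (p (k + 1)) - h (p k))‖ ^ 2
      = ∑ k ∈ Finset.range n, γ k ^ 2 * (V (p (k + 1)) - V (p k)) := by
  rw [← real_inner_self_eq_norm_sq, sum_inner]
  refine Finset.sum_congr rfl fun k hk => ?_
  have hkn := Finset.mem_range.1 hk
  rw [inner_sum, Finset.sum_eq_single_of_mem k hk]
  · rw [real_inner_smul_left, real_inner_smul_right,
      inner_increment_self hV (hU k hkn.le) (hU _ hkn) (hp (Nat.le_succ k))]
    ring
  · intro j hj hjk
    have hjn := Finset.mem_range.1 hj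
    rw [real_inner_smul_left, real_inner_smul_right]
    rcases lt_or_gt_of_ne hjk with hlt | hlt
    · rw [real_inner_comm, inner_increment_eq_zero hV (hU j hjn.le) (hU _ hjn) (hU k hkn.le)
        (hU _ hkn) (hp (Nat.le_succ j)) (hp hlt) (hp (Nat.le_succ k))]
      simp
    · rw [inner_increment_eq_zero hV (hU k hkn.le) (hU _ hkn) (hU j hjn.le)
        (hU _ hjn) (hp (Nat.le_succ k)) (hp hlt) (hp (Nat.le_succ j))]
      simp

lemma inner_sum_increments_eq_zero
    (hV : ∀ s ∈ U, ∀ r ∈ U, s ≤ r → inner ℝ (h s) (h r) = V s)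
    {n m : ℕ} {p q : ℕ → ℝ} (hp : Monotone p) (hq : Monotone q) (hpq : ∀ k ≤ n, p k ≤ q 0)
    (hpU : ∀ k ≤ n, p k ∈ U) (hqU : ∀ k ≤ m, q k ∈ U) (γ δ : ℕ → ℝ) :
    inner ℝ (∑ k ∈ Finset.range n, γ k • (h (p (k + 1)) - h (p k)))
      (∑ k ∈ Finset.range m, δ k • (h (q (k + 1)) - h (q k))) = 0 := by
  rw [sum_inner]
  refine Finset.sum_eq_zero fun k hk => ?_
  rw [inner_sum]
  refine Finset.sum_eq_zero fun j hj => ?_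
  have hkn := Finset.mem_range.1 hk
  have hjm := Finset.mem_range.1 hj
  rw [real_inner_smul_left, real_inner_smul_right,
    inner_increment_eq_zero hV (hpU k hkn.le) (hpU _ hkn) (hqU j hjm.le) (hqU _ hjm)
      (hp (Nat.le_succ k)) ((hpq _ hkn).trans (hq (Nat.zero_le j))) (hq (Nat.le_succ j))]
  simp

end Increments

/-! ### The martingale `e^θ̄ a` and its Gaussian increments -/

section Solution

variable {Ω : Type*} [MeasurableSpace Ω] {P : Measure Ω} [IsProbabilityMeasure P]
  {d : ℕ} {T : ℝ} {θ σ : ℝ → ℝ}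

lemma thetaBar_sub (hint : IntegrableOn θ (Icc 0 T)) {a b : ℝ} (ha : a ∈ Icc 0 T)
    (hb : b ∈ Icc 0 T) : thetaBar θ a b = thetaBar θ 0 b - thetaBar θ 0 a := by
  have hi : ∀ x ∈ Icc 0 T, IntervalIntegrable θ volume 0 x := fun x hx =>
    (intervalIntegrable_iff_integrableOn_Icc_of_le hx.1).2
      (hint.mono_set (Icc_subset_Icc le_rfl hx.2))
  exact (intervalIntegral.integral_interval_sub_left (hi b hb) (hi a ha)).symm

lemma continuousOn_thetaBar (hint : IntegrableOn θ (Icc 0 T)) :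
    ContinuousOn (thetaBar θ 0) (Icc 0 T) := by
  rcases le_or_gt 0 T with hT | hT
  · have := intervalIntegral.continuousOn_primitive_interval (a := 0) (b := T) (f := θ)
      (μ := volume) (by rwa [uIcc_of_le hT])
    rwa [uIcc_of_le hT] at this
  · simp [Icc_eq_empty (not_le.2 hT)]

/-- The clock of `∫ σ dw` is `∫ σ²`, and `σ² = 2θ` makes it `2 θ̄`. -/
lemma inner_indicator_sigma (hσ : ∀ t ∈ Icc (0 : ℝ) T, σ t ^ 2 = 2 * θ t)
    {h : ℝ → Lp ℝ 2 (volume : Measure ℝ)}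
    (hh : ∀ s ∈ Icc 0 T, h s =ᵐ[volume] (Icc 0 s).indicator σ) {s r : ℝ}
    (hs : s ∈ Icc 0 T) (hr : r ∈ Icc 0 T) (hsr : s ≤ r) :
    inner ℝ (h s) (h r) = 2 * thetaBar θ 0 s := by
  rw [L2.inner_def]
  have e : (fun x => inner ℝ (h s x) (h r x)) =ᵐ[volume]
      (Icc 0 s).indicator (fun x => 2 * θ x) := by
    filter_upwards [hh s hs, hh r hr] with x a1 a2
    rw [a1, a2]
    by_cases hx : x ∈ Icc 0 s
    · have hx' : x ∈ Icc 0 r := ⟨hx.1, hx.2.trans hsr⟩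
      rw [indicator_of_mem hx, indicator_of_mem hx', indicator_of_mem hx,
        ← hσ x ⟨hx.1, hx.2.trans hs.2⟩]
      simp [sq]
    · simp [indicator_of_notMem hx]
  rw [integral_congr_ae e, integral_indicator measurableSet_Icc, integral_Icc_eq_integral_Ioc,
    integral_const_mul, thetaBar, intervalIntegral.integral_of_le hs.1]

/-- The Riemann sums of `∫ e^(2θ̄) d(2θ̄)`: this is `tendsto_riemannSum` for the constant path `1`
and the rate `2θ`. It gives the limiting variance of the left-point sums. -/
lemma tendsto_sum_exp_sq (hpos : ∀ t ∈ Icc (0 : ℝ) T, 0 < θ t)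
    (hint : IntegrableOn θ (Icc 0 T)) {r t : ℝ} (hr : r ∈ Icc 0 T) (ht : t ∈ Icc 0 T)
    (hrt : r ≤ t) :
    Tendsto (fun n : ℕ => ∑ k ∈ Finset.range n, Real.exp (thetaBar θ 0 (unifPt r t n k)) ^ 2 *
      (2 * thetaBar θ 0 (unifPt r t n (k + 1)) - 2 * thetaBar θ 0 (unifPt r t n k))) atTop
      (𝓝 (Real.exp (2 * thetaBar θ 0 t) - Real.exp (2 * thetaBar θ 0 r))) := by
  have hsub : Icc r t ⊆ Icc 0 T := Icc_subset_Icc hr.1 ht.2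
  have hΘ : ∀ a ∈ Icc r t, ∀ b ∈ Icc r t,
      ∫ s in a..b, 2 * θ s = 2 * thetaBar θ 0 b - 2 * thetaBar θ 0 a := by
    intro a ha b hb
    rw [intervalIntegral.integral_const_mul, ← mul_sub, ← thetaBar_sub hint (hsub ha) (hsub hb),
      thetaBar]
  have := tendsto_riemannSum (θ := fun s => 2 * θ s) (Θ := fun s => 2 * thetaBar θ 0 s)
    (x := fun _ => 1) hrt (fun s hs => by linarith [hpos s (hsub hs)])
    ((hint.mono_set hsub).const_mul 2) hΘ
    (((continuousOn_thetaBar hint).mono hsub).const_mul 2) continuousOn_const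
  simp only [mul_one, sub_self, zero_add] at this
  refine this.congr fun n => Finset.sum_congr rfl fun k hk => ?_
  have hkn := Finset.mem_range.1 hk
  rw [hΘ _ (unifPt_mem hrt hkn.le) _ (unifPt_mem hrt hkn), ← Real.exp_nat_mul]
  norm_num

/-- The initial variable and the increments of the martingale `e^{θ̄_t} a_t` over `[0, s]` and
`[s, t]` are independent, and the increments are isotropic centred Gaussian. -/
lemma integral_exp_increments
    (hpos : ∀ t ∈ Icc (0 : ℝ) T, 0 < θ t) (hint : IntegrableOn θ (Icc 0 T))
    (hσ : ∀ t ∈ Icc (0 : ℝ) T, σ t ^ 2 = 2 * θ t)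
    {w : ℝ≥0 → Ω → EuclideanSpace ℝ (Fin d)} (hw : IsWiener w P)
    {a : ℝ → Ω → EuclideanSpace ℝ (Fin d)} (ha : IsSolution θ σ T w a P)
    {s t : ℝ} (hs : 0 ≤ s) (hst : s ≤ t) (htT : t ≤ T) (u v y : EuclideanSpace ℝ (Fin d)) :
    ∫ ω, Complex.exp ((((inner ℝ (a 0 ω) u + (∑ i,
        (v i * (Real.exp (thetaBar θ 0 s) * a s ω i - a 0 ω i)
          + y i * (Real.exp (thetaBar θ 0 t) * a t ω i - Real.exp (thetaBar θ 0 s) * a s ω i)))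
        : ℝ)) : ℂ) * Complex.I) ∂P
      = charFun (P.map (a 0)) u * Complex.exp (-((∑ i, (v i ^ 2 * (Real.exp (2 * thetaBar θ 0 s) - 1)
          + y i ^ 2 * (Real.exp (2 * thetaBar θ 0 t) - Real.exp (2 * thetaBar θ 0 s))) / 2
          : ℝ) : ℂ)) := by
  have h0T : (0 : ℝ) ∈ Icc 0 T := ⟨le_rfl, hs.trans (hst.trans htT)⟩
  have hsT : s ∈ Icc 0 T := ⟨hs, hst.trans htT⟩
  have htT' : t ∈ Icc 0 T := ⟨hs.trans hst, htT⟩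
  have hB : ∀ i, IsPreBrownianReal (fun t ω => w t ω i) P := fun i =>
    (hw.coord i).toIsPreBrownianReal
  -- The condition on `r` sits inside the existential so that `choose` yields `z i r`, the pair of
  -- `1_[0,r] σ` and its integral, as a function of every real `r`.
  have hex : ∀ i r, ∃ z : Lp ℝ 2 (volume : Measure ℝ) × Lp ℝ 2 P, r ∈ Icc 0 T →
      z ∈ wienerGraph (hB i) ∧ z.1 =ᵐ[volume] (Icc 0 r).indicator σ ∧
      z.2 =ᵐ[P] fun ω => a r ω i - a 0 ω i + ∫ q in (0 : ℝ)..r, θ q * a q ω i := by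
    intro i r
    by_cases hr : r ∈ Icc 0 T
    · obtain ⟨z, h1, h2, h3⟩ := (ha.sde r hr i).exists_mem_wienerGraph (hB i)
      exact ⟨z, fun _ => ⟨h1, h2, h3⟩⟩
    · exact ⟨0, fun h => absurd h hr⟩
  choose z hz using hex
  set Θ := thetaBar θ 0 with hΘdef
  have hΘ0 : Θ 0 = 0 := by simp [hΘdef, thetaBar]
  -- left-point sums over the uniform partition of `[r, t]`
  set S : ℝ → ℝ → ℕ → Fin d → Lp ℝ 2 (volume : Measure ℝ) × Lp ℝ 2 P := fun r t n i =>
    ∑ k ∈ Finset.range n, Real.exp (Θ (unifPt r t n k)) •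
      (z i (unifPt r t n (k + 1)) - z i (unifPt r t n k)) with hS
  have hptT : ∀ {r t : ℝ}, r ∈ Icc 0 T → t ∈ Icc 0 T → r ≤ t → ∀ {n k : ℕ}, k ≤ n →
      unifPt r t n k ∈ Icc 0 T := fun hr ht hrt n k hk =>
    Icc_subset_Icc hr.1 ht.2 (unifPt_mem hrt hk)
  have hSmem : ∀ {r t : ℝ}, r ∈ Icc 0 T → t ∈ Icc 0 T → r ≤ t → ∀ n i,
      S r t n i ∈ wienerGraph (hB i) := by
    intro r t hr ht hrt n i
    refine Submodule.sum_mem _ fun k hk => Submodule.smul_mem _ _ (Submodule.sub_mem _ ?_ ?_)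
    · exact (hz i _ (hptT hr ht hrt (Finset.mem_range.1 hk))).1
    · exact (hz i _ (hptT hr ht hrt (Finset.mem_range.1 hk).le)).1
  have hV : ∀ i, ∀ p ∈ Icc 0 T, ∀ q ∈ Icc 0 T, p ≤ q →
      inner ℝ ((z i p).1) ((z i q).1) = 2 * Θ p := fun i p hp q hq hpq =>
    inner_indicator_sigma hσ (h := fun p => (z i p).1) (fun r hr => (hz i r hr).2.1) hp hq hpq
  have hS1 : ∀ r t n i, (S r t n i).1 = ∑ k ∈ Finset.range n, Real.exp (Θ (unifPt r t n k)) •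
      ((z i (unifPt r t n (k + 1))).1 - (z i (unifPt r t n k)).1) := fun r t n i => by
    rw [hS, Prod.fst_sum]; rfl
  have hS2 : ∀ r t n i, (S r t n i).2 = ∑ k ∈ Finset.range n, Real.exp (Θ (unifPt r t n k)) •
      ((z i (unifPt r t n (k + 1))).2 - (z i (unifPt r t n k)).2) := fun r t n i => by
    rw [hS, Prod.snd_sum]; rfl
  have hnorm : ∀ {r t : ℝ}, r ∈ Icc 0 T → t ∈ Icc 0 T → r ≤ t → ∀ i,
      Tendsto (fun n => ‖(S r t n i).1‖ ^ 2) atTop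
        (𝓝 (Real.exp (2 * Θ t) - Real.exp (2 * Θ r))) := by
    intro r t hr ht hrt i
    refine (tendsto_sum_exp_sq hpos hint hr ht hrt).congr fun n => ?_
    rw [hS1, norm_sq_sum_increments (h := fun p => (z i p).1) (V := fun p => 2 * Θ p) (hV i)
      (unifPt_mono hrt n) (fun k hk => hptT hr ht hrt hk)]
  have horth : ∀ n i, inner ℝ ((S 0 s n i).1) ((S s t n i).1) = 0 := by
    intro n i
    rw [hS1, hS1]
    exact inner_sum_increments_eq_zero (h := fun p => (z i p).1) (V := fun p => 2 * Θ p) (hV i)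
      (unifPt_mono hs n) (unifPt_mono hst n)
      (fun k hk => by rw [unifPt_zero]; exact (unifPt_mem hs hk).2)
      (fun k hk => hptT h0T hsT hs hk) (fun k hk => hptT hsT htT' hst hk) _ _
  -- pathwise convergence
  have hpath : ∀ {r t : ℝ}, r ∈ Icc 0 T → t ∈ Icc 0 T → r ≤ t → ∀ i, ∀ᵐ ω ∂P,
      Tendsto (fun n => (S r t n i).2 ω) atTop
        (𝓝 (Real.exp (Θ t) * a t ω i - Real.exp (Θ r) * a r ω i)) := by
    intro r t hr ht hrt i
    have hsub : Icc r t ⊆ Icc 0 T := Icc_subset_Icc hr.1 ht.2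
    have e1 : ∀ᵐ ω ∂P, ∀ n, (S r t n i).2 ω = ∑ k ∈ Finset.range n,
        Real.exp (Θ (unifPt r t n k)) *
          ((z i (unifPt r t n (k + 1))).2 ω - (z i (unifPt r t n k)).2 ω) := by
      refine ae_all_iff.2 fun n => ?_
      have e2 : ∀ᵐ ω ∂P, ∀ k, (Real.exp (Θ (unifPt r t n k)) •
          ((z i (unifPt r t n (k + 1))).2 - (z i (unifPt r t n k)).2) : Lp ℝ 2 P) ω
          = Real.exp (Θ (unifPt r t n k)) *
          ((z i (unifPt r t n (k + 1))).2 ω - (z i (unifPt r t n k)).2 ω) := by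
        refine ae_all_iff.2 fun k => ?_
        filter_upwards [Lp.coeFn_smul (Real.exp (Θ (unifPt r t n k)))
          ((z i (unifPt r t n (k + 1))).2 - (z i (unifPt r t n k)).2),
          Lp.coeFn_sub (z i (unifPt r t n (k + 1))).2 (z i (unifPt r t n k)).2] with ω a1 a2
        rw [a1, Pi.smul_apply, a2, Pi.sub_apply, smul_eq_mul]
      rw [hS2]
      filter_upwards [e2, Lp.coeFn_finsetSum (μ := P) (Finset.range n) (fun k =>
        Real.exp (Θ (unifPt r t n k)) •
          ((z i (unifPt r t n (k + 1))).2 - (z i (unifPt r t n k)).2))] with ω a1 a2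
      rw [a2, Finset.sum_apply]
      exact Finset.sum_congr rfl fun k _ => a1 k
    -- The equation holds off a null set depending on the time; only countably many partition points
    -- occur, so one null set serves them all.
    have e3 : ∀ᵐ ω ∂P, ∀ n k, k ≤ n → (z i (unifPt r t n k)).2 ω
        = a (unifPt r t n k) ω i - a 0 ω i + ∫ q in (0 : ℝ)..(unifPt r t n k), θ q * a q ω i := by
      refine ae_all_iff.2 fun n => ae_all_iff.2 fun k => ?_
      by_cases hk : k ≤ n
      · filter_upwards [(hz i _ (hptT hr ht hrt hk)).2.2] with ω hω _ using hω
      · exact Eventually.of_forall fun ω h => absurd h hk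
    filter_upwards [e1, e3, ha.continuous] with ω h1 h3 hc
    have hci : ContinuousOn (fun q => a q ω i) (Icc 0 T) :=
      (EuclideanSpace.proj (𝕜 := ℝ) i).continuous.comp_continuousOn hc
    have hint' : ∀ q ∈ Icc 0 T,
        IntervalIntegrable (fun q => θ q * a q ω i) volume 0 q := fun q hq =>
      ((intervalIntegrable_iff_integrableOn_Icc_of_le hq.1).2
        (hint.mono_set (Icc_subset_Icc le_rfl hq.2))).mul_continuousOn
        (by rw [uIcc_of_le hq.1]; exact hci.mono (Icc_subset_Icc le_rfl hq.2))
    have := tendsto_riemannSum (θ := θ) (Θ := Θ) (x := fun q => a q ω i) hrt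
      (fun q hq => (hpos q (hsub hq)).le) (hint.mono_set hsub)
      (fun p hp q hq => thetaBar_sub hint (hsub hp) (hsub hq))
      ((continuousOn_thetaBar hint).mono hsub) (hci.mono hsub)
    refine this.congr fun n => ?_
    rw [h1 n]
    refine Finset.sum_congr rfl fun k hk => ?_
    have hkn := Finset.mem_range.1 hk
    rw [h3 n _ hkn, h3 n k hkn.le, ← intervalIntegral.integral_interval_sub_left
      (hint' _ (hptT hr ht hrt hkn)) (hint' _ (hptT hr ht hrt hkn.le))]
    ring
  -- characteristic function of the approximations
  set Z : ℕ → Fin d → Lp ℝ 2 (volume : Measure ℝ) × Lp ℝ 2 P := fun n i =>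
    v i • S 0 s n i + y i • S s t n i with hZ
  have hZmem : ∀ n i, Z n i ∈ wienerGraph (hB i) := fun n i =>
    Submodule.add_mem _ (Submodule.smul_mem _ _ (hSmem h0T hsT hs n i))
      (Submodule.smul_mem _ _ (hSmem hsT htT' hst n i))
  have hmain := fun n => integral_exp_mul_exp_of_mem_wienerGraph hB hw.indep
    (ha.aemeasurable 0 h0T) ha.indep u (Z n) (hZmem n)
  have hZnorm : ∀ i, Tendsto (fun n => ‖(Z n i).1‖ ^ 2) atTop
      (𝓝 (v i ^ 2 * (Real.exp (2 * Θ s) - 1)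
        + y i ^ 2 * (Real.exp (2 * Θ t) - Real.exp (2 * Θ s)))) := by
    intro i
    have h1 := (hnorm h0T hsT hs i).const_mul (v i ^ 2)
    have h2 := (hnorm hsT htT' hst i).const_mul (y i ^ 2)
    rw [hΘ0, mul_zero, Real.exp_zero] at h1
    refine (h1.add h2).congr fun n => ?_
    have : (Z n i).1 = v i • (S 0 s n i).1 + y i • (S s t n i).1 := rfl
    rw [this, norm_add_sq_real, real_inner_smul_left, real_inner_smul_right, horth, norm_smul,
      norm_smul, mul_pow, mul_pow, Real.norm_eq_abs, Real.norm_eq_abs, sq_abs, sq_abs]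
    ring
  have hrhs : Tendsto (fun n => charFun (P.map (a 0)) u
      * Complex.exp (-((∑ i, ‖(Z n i).1‖ ^ 2 / 2 : ℝ) : ℂ))) atTop
      (𝓝 (charFun (P.map (a 0)) u * Complex.exp (-((∑ i,
        (v i ^ 2 * (Real.exp (2 * Θ s) - 1)
          + y i ^ 2 * (Real.exp (2 * Θ t) - Real.exp (2 * Θ s))) / 2 : ℝ) : ℂ)))) := by
    refine Tendsto.const_mul _ ?_
    refine (Complex.continuous_exp.tendsto _).comp (Tendsto.neg ?_)
    refine (Complex.continuous_ofReal.tendsto _).comp ?_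
    exact tendsto_finsetSum _ fun i _ => (hZnorm i).div_const 2
  have hZpath : ∀ᵐ ω ∂P, Tendsto (fun n => (∑ i, (Z n i).2 : Lp ℝ 2 P) ω) atTop
      (𝓝 (∑ i, (v i * (Real.exp (Θ s) * a s ω i - a 0 ω i)
          + y i * (Real.exp (Θ t) * a t ω i - Real.exp (Θ s) * a s ω i)))) := by
    have e1 : ∀ᵐ ω ∂P, ∀ n, (∑ i, (Z n i).2 : Lp ℝ 2 P) ω
        = ∑ i, (v i * (S 0 s n i).2 ω + y i * (S s t n i).2 ω) := by
      refine ae_all_iff.2 fun n => ?_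
      have e2 : ∀ᵐ ω ∂P, ∀ i, (Z n i).2 ω = v i * (S 0 s n i).2 ω + y i * (S s t n i).2 ω := by
        refine ae_all_iff.2 fun i => ?_
        filter_upwards [Lp.coeFn_add (v i • (S 0 s n i).2) (y i • (S s t n i).2),
          Lp.coeFn_smul (v i) (S 0 s n i).2, Lp.coeFn_smul (y i) (S s t n i).2] with ω a1 a2 a3
        rw [Pi.add_apply, a2, a3] at a1
        exact a1
      filter_upwards [e2, Lp.coeFn_finsetSum (μ := P) Finset.univ (fun i => (Z n i).2)]
        with ω a1 a2
      rw [a2, Finset.sum_apply]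
      exact Finset.sum_congr rfl fun i _ => a1 i
    filter_upwards [e1, ae_all_iff.2 (hpath h0T hsT hs), ae_all_iff.2 (hpath hsT htT' hst)]
      with ω h1 h2 h3
    simp only [h1]
    refine tendsto_finsetSum _ fun i _ => ?_
    have h2i := h2 i
    rw [hΘ0, Real.exp_zero, one_mul] at h2i
    exact (h2i.const_mul _).add ((h3 i).const_mul _)
  have hA : AEMeasurable (fun ω => (inner ℝ (a 0 ω) u : ℝ)) P :=
    (ha.aemeasurable 0 h0T).inner_const
  -- The integrands have modulus `1`, so pathwise convergence of the sums suffices here, while the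
  -- right side needs only convergence of their norms in `L²(ℝ)`. No limit in `L²(P)` is taken.
  have hlhs := tendsto_integral_of_dominated_convergence (μ := P)
    (F := fun n ω => Complex.exp (((inner ℝ (a 0 ω) u : ℝ) : ℂ) * Complex.I)
        * Complex.exp ((((∑ i, (Z n i).2 : Lp ℝ 2 P) ω : ℝ) : ℂ) * Complex.I))
    (f := fun ω => Complex.exp ((((inner ℝ (a 0 ω) u + (∑ i,
        (v i * (Real.exp (Θ s) * a s ω i - a 0 ω i)
          + y i * (Real.exp (Θ t) * a t ω i - Real.exp (Θ s) * a s ω i)))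
        : ℝ)) : ℂ) * Complex.I)) (fun _ => 1)
    (fun n => by
      have := (Lp.aestronglyMeasurable (∑ i, (Z n i).2 : Lp ℝ 2 P)).aemeasurable
      exact AEMeasurable.aestronglyMeasurable (by fun_prop))
    (integrable_const _)
    (fun n => Eventually.of_forall fun ω => by
      rw [norm_mul, Complex.norm_exp_ofReal_mul_I, Complex.norm_exp_ofReal_mul_I, one_mul])
    (by
      filter_upwards [hZpath] with ω hω
      rw [Complex.ofReal_add, add_mul, Complex.exp_add]
      refine Tendsto.const_mul _ ((Complex.continuous_exp.tendsto _).comp ?_)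
      exact ((Complex.continuous_ofReal.tendsto _).comp hω).mul_const _)
  exact tendsto_nhds_unique (hlhs.congr hmain) hrhs

end Solution

/-! ### From independence of the residual to the conditional law -/

section CondDistrib

/-- If `Y - m(X)` is independent of `X` with law `ν`, then the conditional law of `Y` given `X = x`
is the translate of `ν` by `m x`. -/
lemma condDistrib_ae_eq_map_add {Ω F E : Type*} [MeasurableSpace Ω] {P : Measure Ω}
    [IsProbabilityMeasure P] [MeasurableSpace F] [NormedAddCommGroup E] [MeasurableSpace E]
    [BorelSpace E] [SecondCountableTopology E] [StandardBorelSpace E]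
    {X : Ω → F} {Y : Ω → E} {m : F → E} (hX : AEMeasurable X P) (hY : AEMeasurable Y P)
    (hm : Measurable m) (hind : IndepFun X (fun ω => Y ω - m (X ω)) P) :
    ∀ᵐ x ∂(P.map X), condDistrib Y X P x
      = (P.map fun ω => Y ω - m (X ω)).map (fun z => m x + z) := by
  set Z : Ω → E := fun ω => Y ω - m (X ω) with hZdef
  have hZ : AEMeasurable Z P := hY.sub (hm.comp_aemeasurable hX)
  have := Measure.isProbabilityMeasure_map (μ := P) hZ
  have := Measure.isProbabilityMeasure_map (μ := P) hX
  set f : F × E → E := fun p => m p.1 + p.2 with hf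
  have hfm : Measurable f := (hm.comp measurable_fst).add measurable_snd
  set κ : Kernel F E := (Kernel.id ×ₖ Kernel.const F (P.map Z)).map f with hκdef
  have hκ : ∀ x, κ x = (P.map Z).map (fun z => m x + z) := by
    intro x
    rw [hκdef, Kernel.map_apply _ hfm, Kernel.prod_apply, Kernel.id_apply, Kernel.const_apply,
      Measure.dirac_prod, Measure.map_map hfm measurable_prodMk_left]
    rfl
  have : IsMarkovKernel κ := Kernel.IsMarkovKernel.map _ hfm
  -- The joint law is the product law of `(X, Z)` pushed forward by the shear `(x, z) ↦ (x, m x +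
  -- z)`, whose fibre over `x` is `κ x`; disintegration is almost everywhere unique.
  have hjoint : P.map (fun ω => (X ω, Y ω)) = P.map X ⊗ₘ κ := by
    have hXZ := (indepFun_iff_map_prod_eq_prod_map_map hX hZ).1 hind
    have hg : Measurable fun p : F × E => (p.1, m p.1 + p.2) := by fun_prop
    have e : (fun ω => (X ω, Y ω)) = (fun p : F × E => (p.1, m p.1 + p.2)) ∘
        fun ω => (X ω, Z ω) := by
      ext ω <;> simp [hZdef]
    rw [e, ← AEMeasurable.map_map_of_aemeasurable hg.aemeasurable (hX.prodMk hZ), hXZ]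
    ext s hs
    rw [Measure.map_apply hg hs, Measure.prod_apply (hg hs), Measure.compProd_apply hs]
    refine lintegral_congr fun x => ?_
    rw [hκ, Measure.map_apply (measurable_const_add _) (measurable_prodMk_left hs)]
    rfl
  filter_upwards [condDistrib_ae_eq_of_measure_eq_compProd X hY hjoint] with x hx
  rw [hx, hκ]

lemma multivariateGaussian_eq_map_add {ι : Type*} [Fintype ι] [DecidableEq ι]
    (μ : EuclideanSpace ℝ ι) (S : Matrix ι ι ℝ) :
    multivariateGaussian μ S = (multivariateGaussian 0 S).map (fun z => μ + z) := by
  rw [multivariateGaussian, multivariateGaussian, Measure.map_map (by fun_prop) (by fun_prop)]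
  congr 1
  ext x : 1
  simp

lemma charFun_multivariateGaussian_smul_one {ι : Type*} [Fintype ι] [DecidableEq ι]
    {β : ℝ} (hβ : 0 ≤ β) (z : EuclideanSpace ℝ ι) :
    charFun (multivariateGaussian 0 (β • (1 : Matrix ι ι ℝ))) z
      = Complex.exp (-((∑ i, β * z i ^ 2 / 2 : ℝ) : ℂ)) := by
  rw [charFun_multivariateGaussian (Matrix.PosSemidef.one.smul hβ)]
  congr 1
  simp only [inner_zero_right, Complex.ofReal_zero, zero_mul, zero_sub, Matrix.smul_mulVec,
    Matrix.one_mulVec, dotProduct, Pi.smul_apply, smul_eq_mul]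
  push_cast
  rw [Finset.sum_div]
  congr 1
  exact Finset.sum_congr rfl fun i _ => by ring

/-- The vectors `X₁, X₂` are jointly independent of `Z`, and `Z` is isotropic Gaussian, as soon as
the joint characteristic function factorises accordingly. -/
lemma indepFun_prodMk_of_charFun {Ω : Type*} [MeasurableSpace Ω] {P : Measure Ω}
    [IsProbabilityMeasure P] {d : ℕ} {X₁ X₂ Z : Ω → EuclideanSpace ℝ (Fin d)}
    (h₁ : AEMeasurable X₁ P) (h₂ : AEMeasurable X₂ P) (hZ : AEMeasurable Z P)
    {β : ℝ} (hβ : 0 ≤ β)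
    {G : EuclideanSpace ℝ (Fin d) → EuclideanSpace ℝ (Fin d) → ℂ} (hG : G 0 0 = 1)
    (h : ∀ p q z, ∫ ω, Complex.exp (((inner ℝ (X₁ ω) p + inner ℝ (X₂ ω) q
      + inner ℝ (Z ω) z : ℝ) : ℂ) * Complex.I) ∂P
        = G p q * Complex.exp (-((∑ i, β * z i ^ 2 / 2 : ℝ) : ℂ))) :
    IndepFun (fun ω => (X₁ ω, X₂ ω)) Z P ∧
      P.map Z = multivariateGaussian 0 (β • (1 : Matrix (Fin d) (Fin d) ℝ)) := by
  -- The `L²` product norm makes the pair a vector in an inner product space, where `charFun` is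
  -- available.
  have hX : AEMeasurable (fun ω => WithLp.toLp 2 (X₁ ω, X₂ ω)) P := by fun_prop
  have hZc : ∀ z, charFun (P.map Z) z = Complex.exp (-((∑ i, β * z i ^ 2 / 2 : ℝ) : ℂ)) := by
    intro z
    have := h 0 0 z
    rw [hG, one_mul] at this
    rw [charFun_apply, integral_map hZ (by fun_prop), ← this]
    simp
  have hXc : ∀ x : WithLp 2 (EuclideanSpace ℝ (Fin d) × EuclideanSpace ℝ (Fin d)),
      charFun (P.map fun ω => WithLp.toLp 2 (X₁ ω, X₂ ω)) x = G x.fst x.snd := by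
    intro x
    have := h x.fst x.snd 0
    rw [charFun_apply, integral_map hX (by fun_prop)]
    simpa [WithLp.prod_inner_apply] using this
  constructor
  · have hi : IndepFun (fun ω => WithLp.toLp 2 (X₁ ω, X₂ ω)) Z P := by
      rw [indepFun_iff_charFun_prod hX hZ]
      intro x
      have := h x.fst.fst x.fst.snd x.snd
      rw [hZc, hXc, charFun_apply, integral_map (by fun_prop) (by fun_prop)]
      simpa [WithLp.prod_inner_apply] using this
    exact hi.comp (φ := WithLp.ofLp) (ψ := id) (by fun_prop) measurable_id
  · have := Measure.isProbabilityMeasure_map (μ := P) hZ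
    refine Measure.ext_of_charFun (funext fun z => ?_)
    rw [hZc, charFun_multivariateGaussian_smul_one hβ]

end CondDistrib

/-! ### Posterior mean and variance as rational functions of `es` and `et` -/

section Posterior

variable {T : ℝ} {θ : ℝ → ℝ}

lemma thetaBar_nonneg (hpos : ∀ t ∈ Icc (0 : ℝ) T, 0 < θ t) {a b : ℝ} (ha : 0 ≤ a) (hab : a ≤ b)
    (hb : b ≤ T) : 0 ≤ thetaBar θ a b :=
  intervalIntegral.integral_nonneg hab fun x hx => (hpos x ⟨ha.trans hx.1, hx.2.trans hb⟩).le

lemma thetaBar_pos (hpos : ∀ t ∈ Icc (0 : ℝ) T, 0 < θ t) (hint : IntegrableOn θ (Icc 0 T))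
    {a b : ℝ} (ha : 0 ≤ a) (hab : a < b) (hb : b ≤ T) : 0 < thetaBar θ a b :=
  intervalIntegral.intervalIntegral_pos_of_pos_on
    ((intervalIntegrable_iff_integrableOn_Icc_of_le hab.le).2
      (hint.mono_set (Icc_subset_Icc ha hb)))
    (fun x hx => hpos x ⟨ha.trans hx.1.le, hx.2.le.trans hb⟩) hab

lemma posteriorVar_nonneg (hpos : ∀ t ∈ Icc (0 : ℝ) T, 0 < θ t) {t : ℝ} (ht : t ∈ Icc 1 T) :
    0 ≤ posteriorVar θ t := by
  have key : ∀ {x : ℝ}, 0 ≤ x → 0 ≤ 1 - Real.exp (-2 * x) := fun {x} hx => by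
    have : Real.exp (-2 * x) ≤ 1 := Real.exp_le_one_iff.2 (by linarith)
    linarith
  have h1 := ht.1
  have h2 := ht.2
  exact div_nonneg (mul_nonneg
    (key (thetaBar_nonneg hpos le_rfl (by linarith) (by linarith)))
    (key (thetaBar_nonneg hpos (by linarith) (by linarith) h2)))
    (key (thetaBar_nonneg hpos le_rfl (by linarith) h2))

variable {t es et : ℝ}

/-- With `es = e^θ̄_(t-1)` and `et = e^θ̄_t` every exponential in `μ̃` is a monomial in `es`, `et`
and their inverses, so later identities are pure field algebra. The condition `1 < et` keeps the
denominator nonzero. -/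
lemma posteriorMean_eq {d : ℕ} (hes : Real.exp (thetaBar θ 0 (t - 1)) = es)
    (het : Real.exp (thetaBar θ 0 t) = et) (hlt : 1 < et)
    (hsub : thetaBar θ (t - 1) t = thetaBar θ 0 t - thetaBar θ 0 (t - 1))
    (x y : EuclideanSpace ℝ (Fin d)) :
    posteriorMean θ t x y = (et * ((es ^ 2 - 1) / (es * (et ^ 2 - 1)))) • x
      + ((et ^ 2 - es ^ 2) / (es * (et ^ 2 - 1))) • y := by
  have hs0 : 0 < es := hes ▸ Real.exp_pos _
  have hD : et ^ 2 - 1 ≠ 0 := by nlinarith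
  have ht0 : 0 < et := by linarith
  have e1 : Real.exp (-2 * thetaBar θ 0 (t - 1)) = (es ^ 2)⁻¹ := by
    rw [← hes, ← Real.exp_nat_mul, ← Real.exp_neg]; congr 1; push_cast; ring
  have e2 : Real.exp (-2 * thetaBar θ 0 t) = (et ^ 2)⁻¹ := by
    rw [← het, ← Real.exp_nat_mul, ← Real.exp_neg]; congr 1; push_cast; ring
  have e3 : Real.exp (-thetaBar θ (t - 1) t) = es / et := by
    rw [← hes, ← het, ← Real.exp_sub, hsub]; congr 1; ring
  have e4 : Real.exp (-2 * thetaBar θ (t - 1) t) = (es / et) ^ 2 := by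
    rw [← e3, ← Real.exp_nat_mul]; congr 1; push_cast; ring
  have e5 : Real.exp (-thetaBar θ 0 (t - 1)) = es⁻¹ := by rw [Real.exp_neg, hes]
  have hD' : 1 - (et ^ 2)⁻¹ = (et ^ 2 - 1) / et ^ 2 := by field_simp
  rw [posteriorMean, e1, e2, e3, e4, e5, hD']
  congr 2
  · field_simp
  · field_simp

lemma posteriorVar_eq (hes : Real.exp (thetaBar θ 0 (t - 1)) = es)
    (het : Real.exp (thetaBar θ 0 t) = et) (hlt : 1 < et)
    (hsub : thetaBar θ (t - 1) t = thetaBar θ 0 t - thetaBar θ 0 (t - 1)) :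
    posteriorVar θ t = (es ^ 2 - 1) * (et ^ 2 - es ^ 2) / (es ^ 2 * (et ^ 2 - 1)) := by
  have hs0 : 0 < es := hes ▸ Real.exp_pos _
  have hD : et ^ 2 - 1 ≠ 0 := by nlinarith
  have ht0 : 0 < et := by linarith
  have e1 : Real.exp (-2 * thetaBar θ 0 (t - 1)) = (es ^ 2)⁻¹ := by
    rw [← hes, ← Real.exp_nat_mul, ← Real.exp_neg]; congr 1; push_cast; ring
  have e2 : Real.exp (-2 * thetaBar θ 0 t) = (et ^ 2)⁻¹ := by
    rw [← het, ← Real.exp_nat_mul, ← Real.exp_neg]; congr 1; push_cast; ring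
  have e4 : Real.exp (-2 * thetaBar θ (t - 1) t) = (es / et) ^ 2 := by
    rw [← hes, ← het, ← Real.exp_sub, hsub, ← Real.exp_nat_mul]; congr 1; push_cast; ring
  have hD' : 1 - (et ^ 2)⁻¹ = (et ^ 2 - 1) / et ^ 2 := by field_simp
  rw [posteriorVar, e1, e2, e4, hD']
  field_simp

end Posterior

end MeanReverting

end

theorem proposition3p1 {Ω : Type*} [MeasurableSpace Ω] (P : Measure Ω) [IsProbabilityMeasure P]
    {d : ℕ} (T : ℝ) (θ σ : ℝ → ℝ)
    (hθ_pos : ∀ t ∈ Set.Icc (0 : ℝ) T, 0 < θ t)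
    (hθ_int : IntegrableOn θ (Set.Icc 0 T))
    (hσ_pos : ∀ t ∈ Set.Icc (0 : ℝ) T, 0 < σ t)
    (hσ : ∀ t ∈ Set.Icc (0 : ℝ) T, σ t ^ 2 = 2 * θ t)
    (w : ℝ≥0 → Ω → EuclideanSpace ℝ (Fin d)) (hw : MeanReverting.IsWiener w P)
    (a : ℝ → Ω → EuclideanSpace ℝ (Fin d)) (ha : MeanReverting.IsSolution θ σ T w a P)
    (t : ℝ) (ht : t ∈ Set.Icc 1 T) :
    0 ≤ MeanReverting.posteriorVar θ t ∧
    ∀ᵐ x ∂(P.map (fun ω => (a t ω, a 0 ω))),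
      condDistrib (a (t - 1)) (fun ω => (a t ω, a 0 ω)) P x =
        multivariateGaussian (MeanReverting.posteriorMean θ t x.1 x.2)
          (MeanReverting.posteriorVar θ t • (1 : Matrix (Fin d) (Fin d) ℝ)) := by
  open MeanReverting in
  obtain ⟨ht1, htT⟩ := ht
  have hβ := posteriorVar_nonneg hθ_pos ⟨ht1, htT⟩
  refine ⟨hβ, ?_⟩
  have m0 : (0 : ℝ) ∈ Icc 0 T := ⟨le_rfl, by linarith⟩
  have ms : t - 1 ∈ Icc 0 T := ⟨by linarith, by linarith⟩
  have mt : t ∈ Icc 0 T := ⟨by linarith, htT⟩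
  have hsub := thetaBar_sub hθ_int ms mt
  have hlt : 1 < Real.exp (thetaBar θ 0 t) :=
    Real.one_lt_exp_iff.2 (thetaBar_pos hθ_pos hθ_int le_rfl (by linarith) htT)
  have hsqs : Real.exp (2 * thetaBar θ 0 (t - 1)) = Real.exp (thetaBar θ 0 (t - 1)) ^ 2 := by
    rw [← Real.exp_nat_mul]; norm_num
  have hsqt : Real.exp (2 * thetaBar θ 0 t) = Real.exp (thetaBar θ 0 t) ^ 2 := by
    rw [← Real.exp_nat_mul]; norm_num
  have hmain := fun u v y => integral_exp_increments hθ_pos hθ_int hσ hw ha ms.1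
    (by linarith : t - 1 ≤ t) htT u v y
  rw [hsqs, hsqt] at hmain
  have hmean := fun x y : EuclideanSpace ℝ (Fin d) =>
    posteriorMean_eq (θ := θ) (t := t) rfl rfl hlt hsub x y
  have hvar := posteriorVar_eq (θ := θ) (t := t) rfl rfl hlt hsub
  have hes0 : 0 < Real.exp (thetaBar θ 0 (t - 1)) := Real.exp_pos _
  generalize Real.exp (thetaBar θ 0 (t - 1)) = es at *
  generalize Real.exp (thetaBar θ 0 t) = et at *
  have het0 : 0 < et := by linarith
  have hD : et ^ 2 - 1 ≠ 0 := by nlinarith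
  -- `C` is the weight of `a_0` in `μ̃`, and `et * G` that of `a_t`. As `C + G = es⁻¹`, the `a_0`
  -- terms cancel in the residual, leaving `C M - G N`.
  set C := (et ^ 2 - es ^ 2) / (es * (et ^ 2 - 1)) with hC
  set G := (es ^ 2 - 1) / (es * (et ^ 2 - 1)) with hG
  have hCG : C + G = es⁻¹ := by rw [hC, hG]; field_simp; ring
  -- Vanishing covariance of `C M - G N` with `M + N`; it kills the cross terms in `p` and `z`
  -- below.
  have hcross : C * (es ^ 2 - 1) = G * (et ^ 2 - es ^ 2) := by rw [hC, hG]; ring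
  have hβeq : posteriorVar θ t = C ^ 2 * (es ^ 2 - 1) + G ^ 2 * (et ^ 2 - es ^ 2) := by
    rw [hvar, hC, hG]; field_simp; ring
  have hm : Measurable fun x : EuclideanSpace ℝ (Fin d) × EuclideanSpace ℝ (Fin d) =>
      posteriorMean θ t x.1 x.2 := by
    simp only [hmean]; fun_prop
  have ha0 := ha.aemeasurable 0 m0
  have has := ha.aemeasurable _ ms
  have hat := ha.aemeasurable t mt
  have hX : AEMeasurable (fun ω => (a t ω, a 0 ω)) P := hat.prodMk ha0
  have hZ : AEMeasurable (fun ω => a (t - 1) ω - posteriorMean θ t (a t ω) (a 0 ω)) P :=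
    has.sub (hm.comp_aemeasurable hX)
  -- The factor in `p`, `q` is the characteristic function of `(a_t, a_0)`, from `a_t = et⁻¹ (a_0 +
  -- M + N)` with `M + N` of variance `et² - 1`.
  obtain ⟨hind, hlaw⟩ := indepFun_prodMk_of_charFun (P := P) hat ha0 hZ hβ
    (G := fun p q => charFun (P.map (a 0)) (q + et⁻¹ • p) * Complex.exp (-((∑ i,
      (et⁻¹ * p i) ^ 2 * (et ^ 2 - 1) / 2 : ℝ) : ℂ)))
    (by
      have := Measure.isProbabilityMeasure_map (μ := P) ha0
      simp)
    (fun p q z => by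
      -- These are the coefficients of `a_0`, `M`, `N` when `⟨a_t, p⟩ + ⟨a_0, q⟩ + ⟨C M - G N, z⟩`
      -- is expanded.
      have h := hmain (q + et⁻¹ • p) (et⁻¹ • p + C • z) (et⁻¹ • p - G • z)
      have hl : ∀ ω, (inner ℝ (a 0 ω) (q + et⁻¹ • p) + ∑ i,
          ((et⁻¹ • p + C • z) i * (es * a (t - 1) ω i - a 0 ω i)
            + (et⁻¹ • p - G • z) i * (et * a t ω i - es * a (t - 1) ω i)) : ℝ)
          = inner ℝ (a t ω) p + inner ℝ (a 0 ω) q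
            + inner ℝ (a (t - 1) ω - posteriorMean θ t (a t ω) (a 0 ω)) z := by
        intro ω
        simp only [hmean, PiLp.inner_apply, ← Finset.sum_add_distrib]
        refine Finset.sum_congr rfl fun i _ => ?_
        simp only [RCLike.inner_apply, conj_trivial, PiLp.add_apply, PiLp.sub_apply,
          PiLp.smul_apply, smul_eq_mul]
        have h1 : es * (C + G) = 1 := by rw [hCG]; field_simp
        have h2 : et * et⁻¹ = 1 := by field_simp
        linear_combination (z i * a (t - 1) ω i) * h1 + (p i * a t ω i) * h2
      simp only [hl] at h
      rw [h, mul_assoc, ← Complex.exp_add, ← neg_add, ← Complex.ofReal_add,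
        ← Finset.sum_add_distrib]
      refine congrArg (fun r : ℝ => charFun (P.map (a 0)) (q + et⁻¹ • p)
        * Complex.exp (-(r : ℂ))) (Finset.sum_congr rfl fun i _ => ?_)
      simp only [PiLp.add_apply, PiLp.sub_apply, PiLp.smul_apply, smul_eq_mul]
      rw [hβeq]
      linear_combination (et⁻¹ * p i * z i) * hcross)
  filter_upwards [condDistrib_ae_eq_map_add hX has hm hind] with x hx
  rw [hx, hlaw, ← multivariateGaussian_eq_map_add]
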